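/- Let $[m]=\{1,\dots,m\}$ be a set of items. A function $v:2^{[m]}\to\mathbb{R}$ is a weighted matroid-rank valuation if there are a matroid on $[m]$ and weights $\omega:[m]\to\mathbb{R}_{\ge 0}$ such that $v(S)=\max\{\sum_{a\in A}\omega(a): A\subseteq S,\ A \text{ independent}\}$ for all $S\subseteq[m]$. For $0\le k\le m$, a set $S$ is $k$-optimal for $v$ if $|S|=k$ and $v(T)\le v(S)$ for all $T$ with $|T|=k$. A value query at $S$ returns $v(S)$. A demand query at item prices $p\in\mathbb{R}_{\ge0}^m$ returns some $D\in\arg\max_{S\subseteq[m]}\bigl(v(S)-\sum_{i\in S}p_i\bigr)$ together with $v(D)$, where ties are broken arbitrarily, possibly by an adversary who sees the whole history of the run so far. A randomized algorithm knows $m$ (and $k$, if it is given $k$), accesses $v$ only through value and demand queries, and makes its next step depending on the previous answers and on random draws; its cost is the number of queries it makes. **Theorem.** (1) There is a randomized algorithm and a constant $C$ such that for all $m$, all $0\le k\le m$, every weighted matroid-rank valuation $v$ on $[m]$ and every tie-breaking of the demand queries, the algorithm, given $m$ and $k$, always outputs a $k$-optimal set for $v$, and, if $m\ge2$, the expected number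 of value and demand queries it makes is at most $C\log^3 m$. (2) There is a randomized algorithm and a constant $C$ such that for all $m$, every weighted matroid-rank valuation $v$ on $[m]$ and every tie-breaking of the demand queries, the algorithm, given $m$, always outputs a set $R$ that is a maximum-weight independent set for every matroid and weight function representing $v$ as above, and, if $m\ge2$, the expected number of value and demand queries it makes is at most $C\log^2 m$. -/

import Mathlib

open scoped NNReal ENNReal

/-- `v` is the weighted rank function of the matroid `M` (on the item set `Fin m`) with the
weights `ω`: the value of a bundle `S` is the largest weight of an independent subset of `S`. -/
def IsWeightedRankOf {m : ℕ} (M : Matroid (Fin m)) (ω : Fin m → ℝ≥0)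
    (v : Finset (Fin m) → ℝ) : Prop :=
  M.E = Set.univ ∧
    ∀ S : Finset (Fin m),
      IsGreatest {x : ℝ | ∃ A : Finset (Fin m),
        A ⊆ S ∧ M.Indep (A : Set (Fin m)) ∧ x = ∑ a ∈ A, (ω a : ℝ)} (v S)

/-- Weighted matroid-rank valuations on the item set `Fin m`. -/
def IsWeightedMatroidRank {m : ℕ} (v : Finset (Fin m) → ℝ) : Prop :=
  ∃ (M : Matroid (Fin m)) (ω : Fin m → ℝ≥0), IsWeightedRankOf M ω v

/-- `R` is an independent set of `M` of the largest weight. -/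
def IsMaxWeightIndep {m : ℕ} (M : Matroid (Fin m)) (ω : Fin m → ℝ≥0)
    (R : Finset (Fin m)) : Prop :=
  M.Indep (R : Set (Fin m)) ∧
    ∀ A : Finset (Fin m), M.Indep (A : Set (Fin m)) → ∑ a ∈ A, ω a ≤ ∑ a ∈ R, ω a

/-- `S` has the largest value among the bundles with exactly `k` items. -/
def IsKOptimal {m : ℕ} (v : Finset (Fin m) → ℝ) (k : ℕ) (S : Finset (Fin m)) : Prop :=
  S.card = k ∧ ∀ T : Finset (Fin m), T.card = k → v T ≤ v S

/-- `D` is a demanded bundle at the item prices `p`: it maximizes `v S - p S`. -/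
def IsDemanded {m : ℕ} (v : Finset (Fin m) → ℝ) (p : Fin m → ℝ≥0) (D : Finset (Fin m)) : Prop :=
  ∀ T : Finset (Fin m), v T - ∑ i ∈ T, (p i : ℝ) ≤ v D - ∑ i ∈ D, (p i : ℝ)

/-- Randomized adaptive query algorithms over `m` items with output in `α`. The valuation is
accessible through queries only. The next step may depend in any way on the answers and the
random draws so far; every run ends after finitely many steps. -/
inductive QueryAlg (m : ℕ) (α : Type) : Type
  /-- stop and output `a` -/
  | ret (a : α) : QueryAlg m α
  /-- ask for the value of the bundle `S`; the answer is handed to `next` -/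
  | value (S : Finset (Fin m)) (next : ℝ → QueryAlg m α) : QueryAlg m α
  /-- ask for a demanded bundle at the item prices `p`;
  the returned bundle and its value are handed to `next` -/
  | demand (p : Fin m → ℝ≥0) (next : Finset (Fin m) → ℝ → QueryAlg m α) : QueryAlg m α
  /-- draw a uniformly random element of `{0, …, n}` -/
  | draw (n : ℕ) (next : Fin (n + 1) → QueryAlg m α) : QueryAlg m α

/-- What an adversary who breaks the ties of the demand queries has seen: one step of a run. -/
inductive QueryEvent (m : ℕ) : Type
  | value (S : Finset (Fin m)) : QueryEvent m
  | demand (p : Fin m → ℝ≥0) (D : Finset (Fin m)) : QueryEvent m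
  | draw (n : ℕ) (i : Fin (n + 1)) : QueryEvent m

/-- A demand oracle for `v`: it answers every demand query by some demanded bundle. How it breaks
ties is arbitrary, and may depend on the whole history of the run (latest step first). -/
structure DemandOracle {m : ℕ} (v : Finset (Fin m) → ℝ) where
  answer : List (QueryEvent m) → (Fin m → ℝ≥0) → Finset (Fin m)
  isDemanded : ∀ h p, IsDemanded v p (answer h p)

namespace QueryAlg

/-- The joint law of the output and of the number of (value and demand) queries, when the algorithm
runs on the valuation `v` with the demand oracle `O`, after the history `h`. -/
noncomputable def run {m : ℕ} {α : Type} (v : Finset (Fin m) → ℝ) (O : DemandOracle v) :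
    QueryAlg m α → List (QueryEvent m) → PMF (α × ℕ)
  | ret a, _ => PMF.pure (a, 0)
  | value S next, h =>
      (run v O (next (v S)) (QueryEvent.value S :: h)).map fun x => (x.1, x.2 + 1)
  | demand p next, h =>
      (run v O (next (O.answer h p) (v (O.answer h p)))
        (QueryEvent.demand p (O.answer h p) :: h)).map fun x => (x.1, x.2 + 1)
  | draw n next, h =>
      (PMF.uniformOfFintype (Fin (n + 1))).bind fun i =>
        run v O (next i) (QueryEvent.draw n i :: h)

/-- `a` is a possible output (one of positive probability) on the valuation `v` with oracle `O`. -/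
def IsOutput {m : ℕ} {α : Type} (A : QueryAlg m α) (v : Finset (Fin m) → ℝ) (O : DemandOracle v)
    (a : α) : Prop :=
  ∃ n : ℕ, (a, n) ∈ (A.run v O []).support

/-- The expected number of value and demand queries on the valuation `v` with oracle `O`. -/
noncomputable def expectedQueries {m : ℕ} {α : Type} (A : QueryAlg m α)
    (v : Finset (Fin m) → ℝ) (O : DemandOracle v) : ℝ≥0∞ :=
  ∑' x : α × ℕ, A.run v O [] x * (x.2 : ℝ≥0∞)

end QueryAlg

/-! Demanded bundles at a uniform price `ε > 0` are independent, and such a bundle `D` is heaviest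
among the independent sets with at most `|D|` items. By matroid augmentation, `v D < v (D ∪ S)`
therefore holds exactly when a single item of `S` improves `D` (`lt_value_union_iff`), so two value
queries decide whether `S` contains an improving item, and binary search along a random order finds
a uniformly random one. If this is `i`, then at the price `ω i / 2` the only items that still
improve were improving before and are strictly lighter than `i` (`lt_value_insert_of_price_lt`). A
random pivot lowers the harmonic number of the number of improving items by at least one in
expectation, so there are `O(log m)` rounds of `O(log m)` queries. Once nothing improves `D`, it is
a heaviest independent set `R`.

For `k ≤ |R|`, the `k` heaviest items of `R` are `k`-optimal, by a Lagrangian argument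
(`sum_sub_le`); for larger `k` any `k`-superset of `R` will do. The heaviest items are found by
quickselect. A demand query with price `x` on the candidates and a prohibitive price elsewhere
splits them at a pivot weight `x`, except that items of weight exactly `x` fall on either side at
the adversary's will. The same descent, run on the items of weight different from `x` with key `|ω -
x|`, removes this ambiguity (`ensures_partition`). Each of the `O(log m)` expected quickselect
rounds thus costs `O(log² m)`.

The adversary is handled by `worstCost`, which takes a supremum over demanded bundles at every
demand query; no history needs to be tracked afterwards. -/

/-! ### Worst-case expected cost and a calculus of cost bounds with postconditions -/

namespace QueryAlg

variable {m : ℕ} {α β : Type}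

/-- Sequential composition of query algorithms. -/
def bind : QueryAlg m α → (α → QueryAlg m β) → QueryAlg m β
  | ret a, k => k a
  | value S next, k => value S fun x => (next x).bind k
  | demand p next, k => demand p fun D x => (next D x).bind k
  | draw n next, k => draw n fun i => (next i).bind k

/-- The expectation of the number of queries plus `g` of the output, when the ties of the demand
queries are broken in the worst possible way. -/
noncomputable def worstCost (v : Finset (Fin m) → ℝ) : QueryAlg m α → (α → ℝ≥0∞) → ℝ≥0∞
  | ret a, g => g a
  | value S next, g => 1 + worstCost v (next (v S)) g
  | demand p next, g =>
      1 + ⨆ D : {D : Finset (Fin m) // IsDemanded v p D}, worstCost v (next D.1 (v D.1)) g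
  | draw n next, g => ((n + 1 : ℕ) : ℝ≥0∞)⁻¹ * ∑ i, worstCost v (next i) g

theorem worstCost_bind (v : Finset (Fin m) → ℝ) (A : QueryAlg m α) (k : α → QueryAlg m β)
    (g : β → ℝ≥0∞) :
    (A.bind k).worstCost v g = A.worstCost v fun a => (k a).worstCost v g := by
  induction A with
  | ret a => rfl
  | value S next ih => simp only [bind, worstCost, ih]
  | demand p next ih => simp only [bind, worstCost, ih]
  | draw n next ih => simp only [bind, worstCost, ih]

theorem tsum_bind_mul {γ δ : Type} (p : PMF γ) (q : γ → PMF δ) (f : δ → ℝ≥0∞) :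
    ∑' y, (p.bind q) y * f y = ∑' x, p x * ∑' y, q x y * f y := by
  simp only [PMF.bind_apply, ← ENNReal.tsum_mul_right, ← ENNReal.tsum_mul_left]
  rw [ENNReal.tsum_comm]
  simp only [mul_assoc]

theorem tsum_pure_mul {γ : Type} (a : γ) (f : γ → ℝ≥0∞) :
    ∑' y, (PMF.pure a) y * f y = f a := by
  rw [tsum_eq_single a]
  · simp
  · intro b hb
    simp [PMF.pure_apply, hb]

theorem tsum_map_mul {γ δ : Type} (p : PMF γ) (q : γ → δ) (f : δ → ℝ≥0∞) :
    ∑' y, (p.map q) y * f y = ∑' x, p x * f (q x) := by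
  rw [PMF.map, tsum_bind_mul]
  simp only [Function.comp, tsum_pure_mul]

theorem tsum_succ_mul (p : PMF (α × ℕ)) (g : α → ℝ≥0∞) :
    ∑' y : α × ℕ, (p.map fun x => (x.1, x.2 + 1)) y * ((y.2 : ℝ≥0∞) + g y.1) =
      1 + ∑' y, p y * ((y.2 : ℝ≥0∞) + g y.1) := by
  rw [tsum_map_mul]
  have : ∀ x : α × ℕ, p x * (((x.2 + 1 : ℕ) : ℝ≥0∞) + g x.1) =
      p x + p x * ((x.2 : ℝ≥0∞) + g x.1) := by
    intro x
    push_cast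
    ring
  simp only [this]
  rw [ENNReal.tsum_add, p.tsum_coe]

/-- Every answer of an oracle, whatever the history, is one of the bundles over which the supremum
in `worstCost` runs. -/
theorem tsum_run_le_worstCost (v : Finset (Fin m) → ℝ) (O : DemandOracle v) (A : QueryAlg m α)
    (g : α → ℝ≥0∞) (h : List (QueryEvent m)) :
    ∑' x, A.run v O h x * ((x.2 : ℝ≥0∞) + g x.1) ≤ A.worstCost v g := by
  induction A generalizing h with
  | ret a => simp [run, worstCost]
  | value S next ih =>
    rw [run, tsum_succ_mul]
    exact add_le_add le_rfl (ih _ _)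
  | demand p next ih =>
    rw [run, tsum_succ_mul]
    refine add_le_add le_rfl ((ih _ _ _).trans ?_)
    exact le_iSup (fun D : {D : Finset (Fin m) // IsDemanded v p D} =>
      worstCost v (next D.1 (v D.1)) g) ⟨O.answer h p, O.isDemanded h p⟩
  | draw n next ih =>
    rw [run, tsum_bind_mul, tsum_fintype, worstCost, Finset.mul_sum]
    refine Finset.sum_le_sum fun i _ => ?_
    simp only [PMF.uniformOfFintype_apply, Fintype.card_fin]
    exact mul_le_mul_right (ih i _) _

/-- Whatever the tie-breaking, the algorithm makes at most `c` queries in expectation, and its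
output always satisfies `P`. -/
def Ensures (v : Finset (Fin m) → ℝ) (A : QueryAlg m α) (c : ℝ≥0∞) (P : α → Prop) : Prop :=
  ∀ (g : α → ℝ≥0∞) (b : ℝ≥0∞), (∀ a, P a → g a ≤ b) → A.worstCost v g ≤ c + b

section Ensures

variable {v : Finset (Fin m) → ℝ} {A : QueryAlg m α} {c c' : ℝ≥0∞} {P Q : α → Prop}

theorem Ensures.expectedQueries_le (h : Ensures v A c P) (O : DemandOracle v) :
    A.expectedQueries v O ≤ c := by
  have h1 := (tsum_run_le_worstCost v O A 0 []).trans (h 0 0 fun _ _ => le_rfl)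
  simpa [expectedQueries] using h1

/-- Take for `g` the function that is `0` on `P` and `⊤` off `P`: an output outside `P` of positive
probability would make the expected cost infinite. -/
theorem Ensures.of_isOutput (h : Ensures v A c P) (hc : c ≠ ⊤) (O : DemandOracle v) {a : α}
    (ha : A.IsOutput v O a) : P a := by
  classical
  by_contra hP
  obtain ⟨n, hn⟩ := ha
  have h1 := (tsum_run_le_worstCost v O A (fun a => if P a then 0 else ⊤) []).trans
    (h _ 0 fun a ha => by simp [ha])
  have h2 := (ENNReal.le_tsum (a, n)).trans h1
  simp only [hP, if_false, add_top, add_zero] at h2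
  rw [ENNReal.mul_top ((PMF.mem_support_iff _ _).1 hn)] at h2
  exact hc (top_le_iff.1 h2)

theorem Ensures.weaken (h : Ensures v A c P) (hc : c ≤ c') (hP : ∀ a, P a → Q a) :
    Ensures v A c' Q := fun g b hb =>
  (h g b fun a ha => hb a (hP a ha)).trans (add_le_add hc le_rfl)

theorem ensures_ret {a : α} (ha : P a) : Ensures v (ret a) 0 P := fun g b hb => by
  simpa [worstCost] using hb a ha

theorem Ensures.bind {k : α → QueryAlg m β} {Q : β → Prop} (h : Ensures v A c P)
    (hk : ∀ a, P a → Ensures v (k a) c' Q) : Ensures v (A.bind k) (c + c') Q := fun g b hb => by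
  rw [worstCost_bind, add_assoc]
  exact h _ _ fun a ha => hk a ha g b hb

theorem ensures_value (S : Finset (Fin m)) :
    Ensures v (value S ret) 1 fun x => x = v S := fun g b hb => by
  simpa [worstCost] using hb (v S) rfl

theorem ensures_demand (p : Fin m → ℝ≥0) :
    Ensures v (demand p fun D _ => ret D) 1 fun D => IsDemanded v p D := fun g b hb => by
  simp only [worstCost]
  gcongr
  exact iSup_le fun D => hb D.1 D.2

end Ensures

/-- Draw a uniformly random element of a nonempty finset. -/
noncomputable def pick (s : Finset β) (hs : s.Nonempty) : QueryAlg m β :=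
  draw (s.card - 1) fun i =>
    ret ((s.equivFinOfCardEq (Nat.sub_add_cancel hs.card_pos).symm).symm i : β)

theorem worstCost_pick (v : Finset (Fin m) → ℝ) (s : Finset β) (hs : s.Nonempty)
    (g : β → ℝ≥0∞) :
    (pick s hs : QueryAlg m β).worstCost v g = (s.card : ℝ≥0∞)⁻¹ * ∑ i ∈ s, g i := by
  simp only [pick, worstCost]
  congr 1
  · rw [Nat.sub_add_cancel hs.card_pos]
  rw [Equiv.sum_comp (s.equivFinOfCardEq (Nat.sub_add_cancel hs.card_pos).symm).symm
    (fun x : s => g x), Finset.sum_coe_sort]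

end QueryAlg

/-! ### Harmonic numbers as the potential of random pivoting -/

/-- The harmonic numbers, as extended nonnegative reals. -/
noncomputable def harmonicENN (n : ℕ) : ℝ≥0∞ := ∑ i ∈ Finset.range n, ((i + 1 : ℕ) : ℝ≥0∞)⁻¹

theorem harmonicENN_mono : Monotone harmonicENN := fun _ _ h =>
  Finset.sum_le_sum_of_subset (Finset.range_mono h)

theorem harmonicENN_eq_ofReal (n : ℕ) : harmonicENN n = ENNReal.ofReal (harmonic n : ℝ) := by
  rw [harmonicENN, harmonic, Rat.cast_sum, ENNReal.ofReal_sum_of_nonneg]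
  · refine Finset.sum_congr rfl fun i _ => ?_
    push_cast
    rw [ENNReal.ofReal_inv_of_pos (by positivity), ENNReal.ofReal_add (by positivity) (by simp)]
    simp
  · intro i _
    positivity

theorem harmonicENN_ne_top (n : ℕ) : harmonicENN n ≠ ⊤ := by
  rw [harmonicENN_eq_ofReal]
  exact ENNReal.ofReal_ne_top

theorem succ_mul_harmonicENN (n : ℕ) :
    ((n + 1 : ℕ) : ℝ≥0∞) * harmonicENN (n + 1) = n * harmonicENN n + harmonicENN n + 1 := by
  rw [show harmonicENN (n + 1) = harmonicENN n + ((n + 1 : ℕ) : ℝ≥0∞)⁻¹ from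
    Finset.sum_range_succ _ _, mul_add,
    ENNReal.mul_inv_cancel (by simp) (ENNReal.natCast_ne_top _)]
  push_cast
  ring

/-- A uniformly random element of `L` lowers the harmonic number of the size of `L` by one in
expectation, if only the elements below it (with respect to the key `y`) are kept. -/
theorem sum_harmonicENN_card_lt {ι : Type*} [DecidableEq ι] (y : ι → ℝ) (L : Finset ι) :
    ∑ i ∈ L, harmonicENN (L.filter fun j => y j < y i).card + L.card ≤
      L.card * harmonicENN L.card := by
  induction L using Finset.strongInduction with
  | H L ih =>
    rcases L.eq_empty_or_nonempty with rfl | hL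
    · simp
    · obtain ⟨b, hb, hmax⟩ := L.exists_max_image y hL
      have hcard : L.card = (L.erase b).card + 1 := (Finset.card_erase_add_one hb).symm
      have h1 := ih (L.erase b) (Finset.erase_ssubset hb)
      rw [← Finset.add_sum_erase L _ hb, hcard, succ_mul_harmonicENN]
      have h2 : ∀ i ∈ L.erase b, (L.filter fun j => y j < y i) =
          (L.erase b).filter fun j => y j < y i := by
        intro i hi
        ext j
        simp only [Finset.mem_filter, Finset.mem_erase]
        constructor
        · rintro ⟨hj, hlt⟩
          refine ⟨⟨?_, hj⟩, hlt⟩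
          rintro rfl
          exact absurd (hmax i (Finset.mem_of_mem_erase hi)) (not_le.2 hlt)
        · rintro ⟨⟨_, hj⟩, hlt⟩
          exact ⟨hj, hlt⟩
      rw [Finset.sum_congr rfl fun i hi => by rw [h2 i hi]]
      have h3 : (L.filter fun j => y j < y b).card ≤ (L.erase b).card := by
        refine Finset.card_le_card fun j hj => ?_
        rw [Finset.mem_filter] at hj
        refine Finset.mem_erase.2 ⟨?_, hj.1⟩
        rintro rfl
        exact lt_irrefl _ hj.2
      calc _ = (∑ i ∈ L.erase b, harmonicENN ((L.erase b).filter fun j => y j < y i).card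
              + (L.erase b).card) + harmonicENN (L.filter fun j => y j < y b).card + 1 := by
            push_cast
            ring
        _ ≤ _ := by
          gcongr
          exact harmonicENN_mono h3

/-! ### The first element of a set in a random order -/

/-- The element of `L` that comes first in the order `π`. -/
def firstOf {m : ℕ} (L : Finset (Fin m)) (hL : L.Nonempty) (π : Equiv.Perm (Fin m)) : Fin m :=
  π.symm ((L.image π).min' (hL.image π))

section firstOf

variable {m : ℕ} {L : Finset (Fin m)} (hL : L.Nonempty) (π : Equiv.Perm (Fin m))

theorem apply_firstOf : π (firstOf L hL π) = (L.image π).min' (hL.image π) := by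
  simp [firstOf]

theorem firstOf_mem : firstOf L hL π ∈ L := by
  have h := Finset.min'_mem (L.image π) (hL.image π)
  rw [← apply_firstOf] at h
  simpa using h

theorem apply_firstOf_le {i : Fin m} (hi : i ∈ L) : π (firstOf L hL π) ≤ π i := by
  rw [apply_firstOf]
  exact Finset.min'_le _ _ (Finset.mem_image_of_mem _ hi)

theorem firstOf_eq {i : Fin m} (hi : i ∈ L) (h : ∀ j ∈ L, π i ≤ π j) : firstOf L hL π = i :=
  π.injective (le_antisymm (apply_firstOf_le hL π hi) (h _ (firstOf_mem hL π)))

/-- The first element of `L` in a uniformly random order is uniformly distributed. -/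
theorem sum_firstOf (F : Fin m → ℝ≥0∞) :
    ((Finset.univ : Finset (Equiv.Perm (Fin m))).card : ℝ≥0∞)⁻¹ * ∑ π, F (firstOf L hL π) =
      (L.card : ℝ≥0∞)⁻¹ * ∑ i ∈ L, F i := by
  obtain ⟨i₀, hi₀⟩ := hL
  have hL : L.Nonempty := ⟨i₀, hi₀⟩
  set N : Fin m → ℕ := fun i => ((Finset.univ : Finset (Equiv.Perm (Fin m))).filter
    fun π => firstOf L hL π = i).card with hN
  have hconst : ∀ i ∈ L, N i = N i₀ := by
    intro i hi
    have key : ∀ a ∈ L, ∀ b ∈ L, N a ≤ N b := by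
      intro a ha b hb
      -- Exchanging the positions of `a` and `b` injects the orders in which `a` comes first in `L`
      -- into those in which `b` does.
      refine Finset.card_le_card_of_injOn (fun π => (Equiv.swap a b).trans π) ?_ ?_
      · intro π hπ
        simp only [Finset.coe_filter, Finset.mem_univ, true_and, Set.mem_ofPred_eq] at hπ ⊢
        refine firstOf_eq hL _ hb fun j hj => ?_
        have hle : ∀ j ∈ L, π a ≤ π j := fun j hj => hπ ▸ apply_firstOf_le hL π hj
        simp only [Equiv.trans_apply, Equiv.swap_apply_right]
        refine hle _ ?_
        rw [Equiv.swap_apply_def]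
        split_ifs <;> assumption
      · intro π _ π' _ h
        ext x
        have := DFunLike.congr_fun h (Equiv.swap a b x)
        simpa using congrArg Fin.val this
    exact le_antisymm (key i hi i₀ hi₀) (key i₀ hi₀ i hi)
  have hsum : ∀ G : Fin m → ℝ≥0∞, ∑ π, G (firstOf L hL π) = N i₀ * ∑ i ∈ L, G i := by
    intro G
    rw [← Finset.sum_fiberwise_of_maps_to (g := firstOf L hL) (t := L)
      (fun π _ => firstOf_mem hL π), Finset.mul_sum]
    refine Finset.sum_congr rfl fun i hi => ?_
    rw [Finset.sum_congr rfl fun π hπ => by rw [(Finset.mem_filter.1 hπ).2], Finset.sum_const,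
      nsmul_eq_mul, ← hconst i hi]
  have hcard := hsum fun _ => 1
  simp only [Finset.sum_const, nsmul_eq_mul, mul_one] at hcard
  have hN0 : (N i₀ : ℝ≥0∞) ≠ 0 := by
    intro h0
    rw [h0, zero_mul] at hcard
    simp at hcard
  rw [hsum F, hcard, ENNReal.mul_inv (Or.inl hN0) (Or.inl (ENNReal.natCast_ne_top _)),
    mul_comm _ (L.card : ℝ≥0∞)⁻¹, mul_assoc, ← mul_assoc _ (N i₀ : ℝ≥0∞),
    ENNReal.inv_mul_cancel hN0 (ENNReal.natCast_ne_top _), one_mul]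

end firstOf

/-! ### Randomized descent with binary search -/

namespace QueryAlg

variable {m : ℕ} {σ : Type}

/-- Binary search for the position, in the order `π`, of the first item that is detected by
`test`; it is known to be one of the `2 ^ d` positions from `lo` on. -/
def search (test : Finset (Fin m) → QueryAlg m Bool) (π : Equiv.Perm (Fin m)) :
    ℕ → ℕ → QueryAlg m ℕ
  | 0, lo => ret lo
  | d + 1, lo => (test (Finset.univ.filter fun i => (π i : ℕ) < lo + 2 ^ d)).bind fun b =>
      if b then search test π d lo else search test π d (lo + 2 ^ d)

theorem ensures_search {v : Finset (Fin m) → ℝ} {test : Finset (Fin m) → QueryAlg m Bool}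
    {L : Finset (Fin m)} (hL : L.Nonempty) {c : ℝ≥0∞}
    (htest : ∀ S, Ensures v (test S) c fun b => (b = true ↔ ∃ i ∈ S, i ∈ L))
    (π : Equiv.Perm (Fin m)) (d lo : ℕ) (h1 : lo ≤ π (firstOf L hL π))
    (h2 : (π (firstOf L hL π) : ℕ) < lo + 2 ^ d) :
    Ensures v (search test π d lo) (d * c) fun n => n = π (firstOf L hL π) := by
  induction d generalizing lo with
  | zero =>
    rw [Nat.cast_zero, zero_mul]
    exact ensures_ret (by omega)
  | succ d ih =>
    refine Ensures.weaken (Ensures.bind (c' := d * c) (htest _) fun b hb => ?_)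
      (by push_cast; rw [add_mul, one_mul, add_comm]) fun _ h => h
    simp only [Finset.mem_filter, Finset.mem_univ, true_and] at hb
    split_ifs with hbt
    · obtain ⟨i, hi, hiL⟩ := hb.1 hbt
      exact ih lo h1 (lt_of_le_of_lt (Fin.le_def.1 (apply_firstOf_le hL π hiL)) hi)
    · refine ih _ ?_ (by rw [pow_succ] at h2; omega)
      by_contra hlt
      exact hbt (hb.2 ⟨_, not_le.1 hlt, firstOf_mem hL π⟩)

/-- As long as `test` detects some item in the current state, choose a uniformly random one of the
detected items and update the state with it. -/
noncomputable def descent (test : σ → Finset (Fin m) → QueryAlg m Bool)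
    (step : σ → Fin m → QueryAlg m σ) : ℕ → σ → QueryAlg m σ
  | 0, s => ret s
  | f + 1, s => (test s Finset.univ).bind fun b =>
      if b then
        (pick (Finset.univ : Finset (Equiv.Perm (Fin m))) Finset.univ_nonempty).bind fun π =>
          (search (test s) π (Nat.clog 2 m) 0).bind fun n =>
            -- When `test` is correct, `n` is the position of a detected item, so the default branch
            -- is never taken.
            if h : n < m then (step s (π.symm ⟨n, h⟩)).bind fun s' => descent test step f s'
            else ret s
      else ret s

/-- The potential is the harmonic number of the size of `L s`. One unit of it pays for a binary
search, an update and the test opening the next round; the separate summand `a` pays for the very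
first test. The set `L s` itself is unknown to the algorithm, which is why a random order of all
items is drawn instead of an element of `L s`. -/
theorem ensures_descent {v : Finset (Fin m) → ℝ} {test : σ → Finset (Fin m) → QueryAlg m Bool}
    {step : σ → Fin m → QueryAlg m σ} {I : σ → Prop} {L : σ → Finset (Fin m)} (y : Fin m → ℝ)
    {a c : ℝ≥0∞}
    (htest : ∀ s, I s → ∀ S, Ensures v (test s S) a fun b => (b = true ↔ ∃ i ∈ S, i ∈ L s))
    (hstep : ∀ s, I s → ∀ i ∈ L s, Ensures v (step s i) c fun s' =>
      I s' ∧ L s' ⊆ (L s).filter fun j => y j < y i)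
    (f : ℕ) (s : σ) (hs : I s) (hf : (L s).card ≤ f) :
    Ensures v (descent test step f s)
      (a + (a * (Nat.clog 2 m + 1) + c) * harmonicENN (L s).card) fun s' => I s' ∧ L s' = ∅ := by
  induction f generalizing s with
  | zero =>
    exact (ensures_ret ⟨hs, Finset.card_eq_zero.1 (Nat.le_zero.1 hf)⟩).weaken zero_le fun _ h => h
  | succ f ih =>
    set K : ℝ≥0∞ := a * (Nat.clog 2 m + 1) + c with hK
    refine (htest s hs Finset.univ).bind fun b hb => ?_
    simp only [Finset.mem_univ, true_and] at hb
    split_ifs with hbt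
    swap
    · refine (ensures_ret ⟨hs, ?_⟩).weaken zero_le fun _ h => h
      by_contra hne
      exact hbt (hb.2 (Finset.nonempty_iff_ne_empty.2 hne))
    have hL : (L s).Nonempty := hb.1 hbt
    intro g b hb
    rw [worstCost_bind, worstCost_pick]
    set F : Fin m → ℝ≥0∞ := fun i =>
      K + K * harmonicENN ((L s).filter fun j => y j < y i).card + b with hF
    have h1 : ∀ π : Equiv.Perm (Fin m), ((search (test s) π (Nat.clog 2 m) 0).bind fun n =>
            if h : n < m then (step s (π.symm ⟨n, h⟩)).bind fun s' => descent test step f s'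
            else ret s).worstCost v g ≤ F (firstOf (L s) hL π) := by
      intro π
      set i := firstOf (L s) hL π with hi
      have hsearch := ensures_search hL (htest s hs) π (Nat.clog 2 m) 0 (Nat.zero_le _)
        (by rw [zero_add]; exact (π _).2.trans_le (Nat.le_pow_clog one_lt_two m))
      refine (Ensures.bind (c' := c + (a + K *
        harmonicENN ((L s).filter fun j => y j < y i).card))
        hsearch (Q := fun s' => I s' ∧ L s' = ∅) ?_ g b hb).trans (le_of_eq ?_)
      · rintro n rfl
        rw [dif_pos (π i).2, Fin.eta, Equiv.symm_apply_apply]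
        refine (hstep s hs i (firstOf_mem hL π)).bind fun s' hs' => ?_
        have hcard := Finset.card_le_card hs'.2
        have hlt : ((L s).filter fun j => y j < y i).card < (L s).card := by
          refine Finset.card_lt_card (Finset.filter_ssubset.2 ⟨i, firstOf_mem hL π, lt_irrefl _⟩)
        refine (ih s' hs'.1 (by omega)).weaken ?_ fun _ h => h
        gcongr
        exact harmonicENN_mono hcard
      · rw [hF, hK]
        ring
    refine (mul_le_mul_right (Finset.sum_le_sum fun π _ => h1 π) _).trans ?_
    -- The bound for a given order depends only on its first element in `L s`, so the average over
    -- orders becomes an average over `L s`.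
    rw [sum_firstOf hL F]
    have hc0 : ((L s).card : ℝ≥0∞) ≠ 0 := by simpa using hL.ne_empty
    have h2 : ∑ i ∈ L s, F i ≤ (L s).card * (K * harmonicENN (L s).card + b) := by
      calc ∑ i ∈ L s, F i = K * (∑ i ∈ L s,
            harmonicENN ((L s).filter fun j => y j < y i).card + (L s).card)
              + (L s).card * b := by
            rw [hF]
            simp only [Finset.sum_add_distrib, Finset.sum_const, nsmul_eq_mul, ← Finset.mul_sum]
            ring
        _ ≤ K * ((L s).card * harmonicENN (L s).card) + (L s).card * b := by
            gcongr
            exact sum_harmonicENN_card_lt y (L s)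
        _ = _ := by ring
    calc _ ≤ ((L s).card : ℝ≥0∞)⁻¹ * ((L s).card * (K * harmonicENN (L s).card + b)) := by gcongr
      _ = _ := by
        rw [← mul_assoc, ENNReal.inv_mul_cancel hc0 (ENNReal.natCast_ne_top _), one_mul]

end QueryAlg

/-! ### Demanded bundles at a uniform price -/

namespace IsWeightedRankOf

variable {m : ℕ} {M : Matroid (Fin m)} {ω : Fin m → ℝ≥0} {v : Finset (Fin m) → ℝ}
  {A D S T : Finset (Fin m)}

theorem sum_le (h : IsWeightedRankOf M ω v) (hAS : A ⊆ S) (hA : M.Indep (A : Set (Fin m))) :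
    ∑ a ∈ A, (ω a : ℝ) ≤ v S :=
  (h.2 S).2 ⟨A, hAS, hA, rfl⟩

theorem exists_indep (h : IsWeightedRankOf M ω v) (S : Finset (Fin m)) :
    ∃ A ⊆ S, M.Indep (A : Set (Fin m)) ∧ v S = ∑ a ∈ A, (ω a : ℝ) := by
  obtain ⟨A, hAS, hA, hv⟩ := (h.2 S).1
  exact ⟨A, hAS, hA, hv⟩

theorem eq_sum (h : IsWeightedRankOf M ω v) (hA : M.Indep (A : Set (Fin m))) :
    v A = ∑ a ∈ A, (ω a : ℝ) := by
  refine le_antisymm ?_ (h.sum_le subset_rfl hA)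
  obtain ⟨B, hBA, -, hv⟩ := h.exists_indep A
  exact hv.trans_le (Finset.sum_le_sum_of_subset_of_nonneg hBA fun _ _ _ => (ω _).2)

theorem mono (h : IsWeightedRankOf M ω v) (hST : S ⊆ T) : v S ≤ v T := by
  obtain ⟨A, hAS, hA, hv⟩ := h.exists_indep S
  exact hv.trans_le (h.sum_le (hAS.trans hST) hA)

theorem nonneg (h : IsWeightedRankOf M ω v) (S : Finset (Fin m)) : 0 ≤ v S := by
  obtain ⟨A, -, -, hv⟩ := h.exists_indep S
  exact hv ▸ Finset.sum_nonneg fun _ _ => (ω _).2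

section Demanded

variable {ε : ℝ≥0} {j : Fin m}

/-- An independent subset realizing `v D` has the same value, so at a positive price it cannot be
smaller than `D`. -/
theorem indep_of_isDemanded (h : IsWeightedRankOf M ω v) (hε : 0 < ε)
    (hD : IsDemanded v (fun _ => ε) D) : M.Indep (D : Set (Fin m)) := by
  obtain ⟨A, hAD, hA, hv⟩ := h.exists_indep D
  have h1 := hD A
  rw [hv, h.eq_sum hA] at h1
  simp only [Finset.sum_const, nsmul_eq_mul] at h1
  have h2 : (D.card : ℝ) ≤ A.card := le_of_mul_le_mul_right (by linarith) (NNReal.coe_pos.2 hε)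
  rwa [← Finset.eq_of_subset_of_card_le hAD (by exact_mod_cast h2)]

theorem le_weight_of_isDemanded (h : IsWeightedRankOf M ω v) (hε : 0 < ε)
    (hD : IsDemanded v (fun _ => ε) D) (hj : j ∈ D) : ε ≤ ω j := by
  have hI := h.indep_of_isDemanded hε hD
  have h1 := hD (D.erase j)
  rw [h.eq_sum hI, h.eq_sum (hI.subset (by simp)), ← Finset.add_sum_erase D _ hj,
    ← Finset.add_sum_erase D (fun _ => (ε : ℝ)) hj] at h1
  exact NNReal.coe_le_coe.1 (by linarith)

theorem weight_le_of_isDemanded (h : IsWeightedRankOf M ω v) (hε : 0 < ε)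
    (hD : IsDemanded v (fun _ => ε) D) (hj : j ∉ D)
    (hI : M.Indep (insert j D : Finset (Fin m))) : ω j ≤ ε := by
  have h1 := hD (insert j D)
  rw [h.eq_sum hI, h.eq_sum (h.indep_of_isDemanded hε hD), Finset.sum_insert hj,
    Finset.sum_insert hj] at h1
  exact NNReal.coe_le_coe.1 (by linarith)

theorem sum_le_of_isDemanded (h : IsWeightedRankOf M ω v)
    (hD : IsDemanded v (fun _ => ε) D) (hA : M.Indep (A : Set (Fin m))) (hAD : A.card ≤ D.card) :
    ∑ a ∈ A, (ω a : ℝ) ≤ v D := by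
  have h1 := hD A
  rw [h.eq_sum hA] at h1
  simp only [Finset.sum_const, nsmul_eq_mul] at h1
  have h2 : (A.card : ℝ) * ε ≤ D.card * ε := by gcongr
  linarith

/-- An independent set realizing the larger value must have more items than `D`, by
`sum_le_of_isDemanded`; inside `insert j D` it is everything. -/
theorem indep_insert_of_lt (h : IsWeightedRankOf M ω v)
    (hD : IsDemanded v (fun _ => ε) D) (hj : v D < v (insert j D)) :
    M.Indep (insert j D : Finset (Fin m)) := by
  obtain ⟨A, hAD, hA, hv⟩ := h.exists_indep (insert j D)
  have h1 : D.card < A.card := by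
    by_contra hle
    exact absurd (h.sum_le_of_isDemanded hD hA (not_lt.1 hle)) (not_le.2 (hv ▸ hj))
  rwa [← Finset.eq_of_subset_of_card_le hAD ((Finset.card_insert_le _ _).trans h1)]

theorem notMem_of_lt (hj : v D < v (insert j D)) : j ∉ D := fun hmem => by
  rw [Finset.insert_eq_of_mem hmem] at hj
  exact lt_irrefl _ hj

theorem value_insert (h : IsWeightedRankOf M ω v) (hD : IsDemanded v (fun _ => ε) D)
    (hj : v D < v (insert j D)) : v (insert j D) = v D + ω j := by
  have hI := h.indep_insert_of_lt hD hj
  rw [h.eq_sum hI, h.eq_sum (hI.subset (by simp)), Finset.sum_insert (notMem_of_lt hj), add_comm]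

theorem lt_value_insert (h : IsWeightedRankOf M ω v) (hj : j ∉ D) (hω : 0 < ω j)
    (hI : M.Indep (insert j D : Finset (Fin m))) : v D < v (insert j D) := by
  rw [h.eq_sum hI, h.eq_sum (hI.subset (by simp)), Finset.sum_insert hj]
  exact lt_add_of_pos_left _ (NNReal.coe_pos.2 hω)

/-- This turns the search for an improving item into a group test: a heavier independent set in `D ∪
S` has more items than `D`, so augmentation supplies a single item of `S`. -/
theorem lt_value_union_iff (h : IsWeightedRankOf M ω v) (hε : 0 < ε)
    (hD : IsDemanded v (fun _ => ε) D) (S : Finset (Fin m)) :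
    v D < v (D ∪ S) ↔ ∃ i ∈ S, v D < v (insert i D) := by
  constructor
  · intro hlt
    obtain ⟨A, hAS, hA, hv⟩ := h.exists_indep (D ∪ S)
    -- Discarding items of weight zero keeps the value and guarantees that the augmenting item
    -- strictly improves `D`.
    set B := A.filter fun a => 0 < ω a with hB
    have hBI : M.Indep (B : Set (Fin m)) := 
      hA.subset (Finset.coe_subset.2 (Finset.filter_subset _ _))
    have hsum : ∑ a ∈ B, (ω a : ℝ) = ∑ a ∈ A, (ω a : ℝ) := by
      refine Finset.sum_subset (Finset.filter_subset _ _) fun a ha haB => ?_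
      have : ¬ 0 < ω a := fun hpos => haB (Finset.mem_filter.2 ⟨ha, hpos⟩)
      simpa using this
    have hcard : D.card < B.card := by
      by_contra hle
      have hle' := h.sum_le_of_isDemanded hD hBI (not_lt.1 hle)
      rw [hsum, ← hv] at hle'
      exact absurd hlt (not_lt.2 hle')
    obtain ⟨e, he, heI⟩ := (h.indep_of_isDemanded hε hD).augment hBI
      (by simpa [Set.encard_coe_eq_coe_finsetCard] using hcard)
    have heA := Finset.mem_filter.1 (Finset.mem_coe.1 he.1)
    have heD : e ∉ D := he.2
    refine ⟨e, ?_, h.lt_value_insert heD heA.2 (by simpa using heI)⟩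
    exact (Finset.mem_union.1 (hAS heA.1)).resolve_left heD
  · rintro ⟨i, hi, hlt⟩
    refine hlt.trans_le (h.mono (Finset.insert_subset ?_ Finset.subset_union_left))
    exact Finset.mem_union_right _ hi

/-- Lowering the uniform price below the weight of an item that still improves `D` removes this
item, and all heavier ones, from the improving items. -/
theorem lt_value_insert_of_price_lt (h : IsWeightedRankOf M ω v) {ε' : ℝ≥0} {i : Fin m}
    {D' : Finset (Fin m)} (hε : 0 < ε) (hD : IsDemanded v (fun _ => ε) D)
    (hi : v D < v (insert i D)) (hε' : 0 < ε') (hlt : ε' < ω i)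
    (hD' : IsDemanded v (fun _ => ε') D') (hj : v D' < v (insert j D')) :
    v D < v (insert j D) ∧ ω j < ω i := by
  have hjI := h.indep_insert_of_lt hD' hj
  have hjD' := notMem_of_lt hj
  have hjle := h.weight_le_of_isDemanded hε' hD' hjD' hjI
  have hile := h.weight_le_of_isDemanded hε hD (notMem_of_lt hi) (h.indep_insert_of_lt hD hi)
  have hI := h.indep_of_isDemanded hε hD
  have hI' := h.indep_of_isDemanded hε' hD'
  have hE : ∀ x, x ∈ M.E := fun x => h.1 ▸ Set.mem_univ x
  -- Items of `D` weigh at least `ε ≥ ω i > ε'`, whereas an item independent of `D'` weighs at most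
  -- `ε'`. Since `D'` spans `D`, whatever extends `D'` also extends `D`.
  have hsub : (D : Set (Fin m)) ⊆ M.closure D' := by
    intro a ha
    by_contra hcl
    have haI := (hI'.notMem_closure_iff (hE a)).1 hcl
    have h1 := h.weight_le_of_isDemanded hε' hD' haI.2 (by simpa using haI.1)
    have h2 := h.le_weight_of_isDemanded hε hD ha
    exact absurd (hlt.trans_le (hile.trans (h2.trans h1))) (lt_irrefl _)
  have hjcl : j ∉ M.closure (D : Set (Fin m)) := fun hmem =>
    (hI'.notMem_closure_iff (hE j)).2 ⟨by simpa using hjI, hjD'⟩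
      (M.closure_subset_closure_of_subset_closure hsub hmem)
  have hjI2 := (hI.notMem_closure_iff (hE j)).1 hjcl
  have hpos : 0 < ω j := by
    have := h.value_insert hD' hj
    exact NNReal.coe_pos.1 (by linarith)
  exact ⟨h.lt_value_insert hjI2.2 hpos (by simpa using hjI2.1), hjle.trans_lt hlt⟩

theorem isMaxWeightIndep_of_isDemanded (h : IsWeightedRankOf M ω v) (hε : 0 < ε)
    (hD : IsDemanded v (fun _ => ε) D) (hmax : v Finset.univ ≤ v D) : IsMaxWeightIndep M ω D := by
  refine ⟨h.indep_of_isDemanded hε hD, fun A hA => ?_⟩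
  have h1 := (h.sum_le (Finset.subset_univ A) hA).trans hmax
  rw [h.eq_sum (h.indep_of_isDemanded hε hD)] at h1
  exact_mod_cast h1

end Demanded

/-! ### Weight thresholds and `k`-optimality -/

/-- The heaviest independent set stays optimal after all weights are lowered by `t`. -/
theorem sum_sub_le (h : IsWeightedRankOf M ω v) {R : Finset (Fin m)}
    (hR : IsMaxWeightIndep M ω R) (t : ℝ≥0) (hA : M.Indep (A : Set (Fin m)))
    (hS : S ⊆ R) (hge : ∀ a ∈ S, t ≤ ω a) (hle : ∀ a ∈ R \ S, ω a ≤ t) :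
    ∑ a ∈ A, (ω a : ℝ) - t * A.card ≤ ∑ a ∈ S, (ω a : ℝ) - t * S.card := by
  -- Extend `A` to a basis `B` of `A ∪ R`. The added part `X` lies in `R`, `|R \ X| ≤ |A|`, and
  -- maximality of `R` gives `ω(A) ≤ ω(R) - ω(X)`.
  obtain ⟨J, hJ, hAJ⟩ := hA.subset_isBasis_of_subset
    (show (A : Set (Fin m)) ⊆ ((A ∪ R : Finset (Fin m)) : Set (Fin m)) by simp)
    (by rw [h.1]; exact Set.subset_univ _)
  obtain ⟨B, rfl⟩ : ∃ B : Finset (Fin m), (B : Set (Fin m)) = J := 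
    ⟨J.toFinite.toFinset, by simp⟩
  have hAB : A ⊆ B := Finset.coe_subset.1 hAJ
  have hBsub : B ⊆ A ∪ R := Finset.coe_subset.1 hJ.subset
  have hcard : R.card ≤ B.card := by
    by_contra hlt
    obtain ⟨e, he, heI⟩ := hJ.indep.augment hR.1
      (by simpa [Set.encard_coe_eq_coe_finsetCard] using hlt)
    exact he.2 (hJ.mem_of_insert_indep (by simpa using Or.inr he.1) heI)
  set X := B \ A with hX
  have hXR : X ⊆ R := fun x hx => by
    have := Finset.mem_sdiff.1 hx
    exact (Finset.mem_union.1 (hBsub this.1)).resolve_left this.2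
  have hmax : ∑ a ∈ B, (ω a : ℝ) ≤ ∑ a ∈ R, (ω a : ℝ) := by
    exact_mod_cast hR.2 B hJ.indep
  have hcX : (X.card : ℝ) + A.card = B.card := by
    exact_mod_cast Finset.card_sdiff_add_card_eq_card hAB
  have hsX : ∑ a ∈ X, (ω a : ℝ) + ∑ a ∈ A, (ω a : ℝ) = ∑ a ∈ B, (ω a : ℝ) :=
    Finset.sum_sdiff hAB
  have hcS : ((R \ S).card : ℝ) + S.card = R.card := by
    exact_mod_cast Finset.card_sdiff_add_card_eq_card hS
  have hsS : ∑ a ∈ R \ S, (ω a : ℝ) + ∑ a ∈ S, (ω a : ℝ) = ∑ a ∈ R, (ω a : ℝ) :=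
    Finset.sum_sdiff hS
  have hcXR : ((R \ X).card : ℝ) + X.card = R.card := by
    exact_mod_cast Finset.card_sdiff_add_card_eq_card hXR
  -- Truncating weights at `t` bounds `ω(X)` from below: passing from `R` to `X` loses at most `t`
  -- per item, and the truncated weight of `R` is `ω(R \ S) + t|S|`.
  have hf : ∑ a ∈ X, min (ω a : ℝ) t ≤ ∑ a ∈ X, (ω a : ℝ) :=
    Finset.sum_le_sum fun a _ => min_le_left _ _
  have hf1 : ∑ a ∈ R \ X, min (ω a : ℝ) t + ∑ a ∈ X, min (ω a : ℝ) t =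
    ∑ a ∈ R, min (ω a : ℝ) t := Finset.sum_sdiff hXR
  have hf2 : ∑ a ∈ R \ S, min (ω a : ℝ) t + ∑ a ∈ S, min (ω a : ℝ) t =
    ∑ a ∈ R, min (ω a : ℝ) t := Finset.sum_sdiff hS
  have hf3 : ∑ a ∈ R \ X, min (ω a : ℝ) t ≤ (R \ X).card * t := by
    rw [← nsmul_eq_mul]
    exact Finset.sum_le_card_nsmul _ _ _ fun a _ => min_le_right _ _
  have hf4 : ∑ a ∈ R \ S, min (ω a : ℝ) t = ∑ a ∈ R \ S, (ω a : ℝ) :=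
    Finset.sum_congr rfl fun a ha => min_eq_left (by exact_mod_cast hle a ha)
  have hf5 : ∑ a ∈ S, min (ω a : ℝ) t = S.card * t := by
    rw [Finset.sum_congr rfl fun a ha => min_eq_right (by exact_mod_cast hge a ha),
      Finset.sum_const, nsmul_eq_mul]
  have hkey : ((R \ X).card : ℝ) * t ≤ A.card * t := by
    have : (R.card : ℝ) ≤ B.card := by exact_mod_cast hcard
    exact mul_le_mul_of_nonneg_right (by linarith) t.2
  linarith

/-- Here `t` acts as a Lagrange multiplier for the cardinality constraint; the independent part of a
competitor has at most `|S|` items, so the penalty terms compare in the right direction. -/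
theorem isKOptimal_of_threshold (h : IsWeightedRankOf M ω v) {R : Finset (Fin m)}
    (hR : IsMaxWeightIndep M ω R) (t : ℝ≥0) (hS : S ⊆ R) (hge : ∀ a ∈ S, t ≤ ω a)
    (hle : ∀ a ∈ R \ S, ω a ≤ t) : IsKOptimal v S.card S := by
  refine ⟨rfl, fun T hT => ?_⟩
  obtain ⟨A, hAT, hA, hv⟩ := h.exists_indep T
  have h1 := h.sum_sub_le hR t hA hS hge hle
  have h2 : (t : ℝ) * A.card ≤ t * S.card := by
    have : (A.card : ℝ) ≤ S.card := by exact_mod_cast hT ▸ Finset.card_le_card hAT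
    gcongr
  rw [hv, h.eq_sum (hR.1.subset (Finset.coe_subset.2 hS))]
  linarith

theorem isKOptimal_of_subset (h : IsWeightedRankOf M ω v) {R : Finset (Fin m)}
    (hR : IsMaxWeightIndep M ω R) (hRS : R ⊆ S) : IsKOptimal v S.card S := by
  refine ⟨rfl, fun T _ => ?_⟩
  obtain ⟨A, -, hA, hv⟩ := h.exists_indep T
  rw [hv]
  exact le_trans (by exact_mod_cast hR.2 A hA) (h.sum_le hRS hR.1)

/-- Demanded bundles at a uniform price `q` on an independent set `C`, when the items outside `C`
are too expensive. -/
theorem of_isDemanded_restrict (h : IsWeightedRankOf M ω v) {C : Finset (Fin m)}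
    (hC : M.Indep (C : Set (Fin m))) {q N : ℝ≥0} (hN : v Finset.univ < N)
    (hD : IsDemanded v (fun i => if i ∈ C then q else N) D) :
    D ⊆ C ∧ (∀ a ∈ D, q ≤ ω a) ∧ ∀ a ∈ C, a ∉ D → ω a ≤ q := by
  have hDC : D ⊆ C := by
    intro e he
    by_contra heC
    have h1 := hD (D.erase e)
    rw [← Finset.add_sum_erase D _ he] at h1
    simp only [if_neg heC] at h1
    linarith [h.mono (Finset.subset_univ D), h.nonneg (D.erase e)]
  refine ⟨hDC, fun a ha => ?_, fun a ha haD => ?_⟩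
  · have h1 := hD (D.erase a)
    have hI : M.Indep (D : Set (Fin m)) := hC.subset (Finset.coe_subset.2 hDC)
    rw [← Finset.add_sum_erase D (fun i => ((if i ∈ C then q else N : ℝ≥0) : ℝ)) ha,
      if_pos (hDC ha), h.eq_sum hI, ← Finset.add_sum_erase D _ ha,
      h.eq_sum (hI.subset (by simp))] at h1
    exact NNReal.coe_le_coe.1 (by linarith)
  · have h1 := hD (insert a D)
    have hI : M.Indep (insert a D : Finset (Fin m)) :=
      hC.subset (Finset.coe_subset.2 (Finset.insert_subset ha hDC))
    rw [h.eq_sum hI, h.eq_sum (hI.subset (by simp)), Finset.sum_insert haD,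
      Finset.sum_insert haD] at h1
    simp only [if_pos ha] at h1
    exact NNReal.coe_le_coe.1 (by linarith)

end IsWeightedRankOf

/-! ### The algorithms -/

namespace QueryAlg

variable {m : ℕ}

/-- Does some item of `S` improve `D`? -/
noncomputable def testImproves (D S : Finset (Fin m)) : QueryAlg m Bool :=
  (value D ret).bind fun x => (value (D ∪ S) ret).bind fun y => ret (decide (x < y))

/-- Lower the uniform price to half the weight of the improving item `i`. -/
noncomputable def lowerPrice (D : Finset (Fin m)) (i : Fin m) : QueryAlg m (Finset (Fin m)) :=
  (value D ret).bind fun x => (value (insert i D) ret).bind fun y =>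
    -- The marginal value `y - x` is the weight of `i`; halving it keeps the price positive and
    -- strictly below this weight.
    demand (fun _ => (y - x).toNNReal / 2) fun D' _ => ret D'

/-- Find an independent set of the largest weight. -/
noncomputable def findBasis (m : ℕ) : QueryAlg m (Finset (Fin m)) :=
  (demand (fun _ => 1) fun D _ => ret D).bind fun D => descent testImproves lowerPrice m D

/-- The price `q` for the items of `C`, and a prohibitive price `N` for all other items. -/
noncomputable def cut (C : Finset (Fin m)) (N q : ℝ≥0) : QueryAlg m (Finset (Fin m)) :=
  demand (fun i => if i ∈ C then q else N) fun D _ => ret D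

/-- Does `S` contain an item of `s.2 \ s.1` whose weight is not `x`? Here the weights are at least
`x` on `U` and at most `x` outside. -/
noncomputable def testDeviates (U : Finset (Fin m)) (x : ℝ≥0)
    (s : Finset (Fin m) × Finset (Fin m)) (S : Finset (Fin m)) : QueryAlg m Bool :=
  (value (S ∩ (s.2 \ s.1) ∩ U) ret).bind fun y => (value ((S ∩ (s.2 \ s.1)) \ U) ret).bind fun z =>
    ret (decide (y - (S ∩ (s.2 \ s.1) ∩ U).card * x +
      (((S ∩ (s.2 \ s.1)) \ U).card * x - z) ≠ 0))

/-- Separate from `x` all weights that are at least as far from `x` as the weight of `j`. -/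
noncomputable def narrow (C : Finset (Fin m)) (N x : ℝ≥0) (s : Finset (Fin m) × Finset (Fin m))
    (j : Fin m) : QueryAlg m (Finset (Fin m) × Finset (Fin m)) :=
  (value {j} ret).bind fun y => (cut C N (x + |y - x| / 2).toNNReal).bind fun P =>
    (cut C N (x - |y - x| / 2).toNNReal).bind fun Q => ret (s.1 ∪ P, s.2 ∩ Q)

/-- Find the items of `C` of weight above `x` and those of weight at least `x`. -/
noncomputable def partition (C : Finset (Fin m)) (N x : ℝ≥0) :
    QueryAlg m (Finset (Fin m) × Finset (Fin m)) :=
  (cut C N x).bind fun U => descent (testDeviates U x) (narrow C N x) m (∅, C)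

open Classical in
/-- Some set of `k` items between `A` and `B`. -/
noncomputable def between (A B : Finset (Fin m)) (k : ℕ) : Finset (Fin m) :=
  if h : ∃ S, A ⊆ S ∧ S ⊆ B ∧ S.card = k then h.choose else A

/-- Quickselect: complete `A` by the heaviest items of `C` to a set of `k` items. -/
noncomputable def select (N : ℝ≥0) (k : ℕ) :
    ℕ → Finset (Fin m) → Finset (Fin m) → QueryAlg m (Finset (Fin m))
  | 0, A, _ => ret A
  | f + 1, A, C =>
    if hC : C.Nonempty then
      (pick C hC).bind fun i => (value {i} ret).bind fun x =>
        (partition C N x.toNNReal).bind fun s =>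
          if k ≤ (A ∪ s.1).card then select N k f A s.1
          else if k ≤ (A ∪ s.2).card then ret (between (A ∪ s.1) (A ∪ s.2) k)
          else select N k f (A ∪ s.2) (C \ s.2)
    else ret A

/-- Find a `k`-optimal set. -/
noncomputable def findKOptimal (m k : ℕ) : QueryAlg m (Finset (Fin m)) :=
  if k = 0 then ret ∅
  else (findBasis m).bind fun R =>
    if R.card ≤ k then ret (between R Finset.univ k)
    else (value Finset.univ ret).bind fun y => select (y + 1).toNNReal k m ∅ R

theorem between_spec {A B : Finset (Fin m)} {k : ℕ} (hAB : A ⊆ B) (hA : A.card ≤ k)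
    (hB : k ≤ B.card) : A ⊆ between A B k ∧ between A B k ⊆ B ∧ (between A B k).card = k := by
  have h : ∃ S, A ⊆ S ∧ S ⊆ B ∧ S.card = k := Finset.exists_subsuperset_card_eq hAB hA hB
  rw [between, dif_pos h]
  exact h.choose_spec

/-- The cost of `findBasis`, and of `partition`. -/
noncomputable def descentCost (m : ℕ) : ℝ≥0∞ :=
  1 + (2 + (2 * (Nat.clog 2 m + 1) + 3) * harmonicENN m)

/-! ### Correctness and cost of the basis search and of the partition -/

section

variable {M : Matroid (Fin m)} {ω : Fin m → ℝ≥0} {v : Finset (Fin m) → ℝ}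

/-- An instance of `ensures_descent` with the weight as key and the improving items as `L`; the
invariant is that `D` is demanded at some positive uniform price. Positivity of the weights in the
output is needed later, for the pivots of `partition`. -/
theorem ensures_findBasis (h : IsWeightedRankOf M ω v) :
    Ensures v (findBasis m) (descentCost m) fun R => IsMaxWeightIndep M ω R ∧ ∀ a ∈ R, 0 < ω a := by
  set I : Finset (Fin m) → Prop := fun D => ∃ ε : ℝ≥0, 0 < ε ∧ IsDemanded v (fun _ => ε) D with hI
  set L : Finset (Fin m) → Finset (Fin m) := fun D =>
    Finset.univ.filter fun i => v D < v (insert i D) with hL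
  refine (ensures_demand _).bind fun D hD => ?_
  refine (ensures_descent (I := I) (L := L) (fun i => (ω i : ℝ)) (a := 2) (c := 3) ?_ ?_ m D
    ⟨1, one_pos, hD⟩ ?_).weaken ?_ ?_
  · rintro D ⟨ε, hε, hD⟩ S
    refine (Ensures.bind (c' := 1 + 0) (ensures_value _) ?_).weaken (by norm_num) fun _ h => h
    rintro _ rfl
    refine (ensures_value _).bind ?_
    rintro _ rfl
    refine ensures_ret ?_
    simp [hL, h.lt_value_union_iff hε hD S]
  · rintro D ⟨ε, hε, hD⟩ i hi
    simp only [hL, Finset.mem_filter, Finset.mem_univ, true_and] at hi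
    refine (Ensures.bind (c' := 1 + 1) (ensures_value _) ?_).weaken (by norm_num) fun _ h => h
    rintro _ rfl
    refine (ensures_value _).bind ?_
    rintro _ rfl
    have hval := h.value_insert hD hi
    have hx : (v (insert i D) - v D).toNNReal = ω i := by rw [hval]; simp
    rw [hx]
    have hpos : 0 < ω i := NNReal.coe_pos.1 (by linarith)
    refine (ensures_demand _).weaken le_rfl fun D' hD' => ⟨⟨_, half_pos hpos, hD'⟩, fun j hj => ?_⟩
    simp only [hL, Finset.mem_filter, Finset.mem_univ, true_and] at hj ⊢
    have := h.lt_value_insert_of_price_lt hε hD hi (half_pos hpos)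
      (NNReal.half_lt_self hpos.ne') hD' hj
    exact ⟨this.1, by exact_mod_cast this.2⟩
  · exact (Finset.card_le_univ _).trans (by simp)
  · gcongr
    exact harmonicENN_mono ((Finset.card_le_univ _).trans (by simp))
  · rintro D' ⟨⟨ε, hε, hD'⟩, hempty⟩
    refine ⟨h.isMaxWeightIndep_of_isDemanded hε hD' ?_, fun a ha =>
      hε.trans_le (h.le_weight_of_isDemanded hε hD' ha)⟩
    by_contra hlt
    obtain ⟨i, -, hi⟩ := (h.lt_value_union_iff hε hD' Finset.univ).1 
      (by rw [Finset.union_eq_right.2 (Finset.subset_univ D')]; exact not_le.1 hlt)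
    exact Finset.notMem_empty i (hempty ▸ Finset.mem_filter.2 ⟨Finset.mem_univ i, hi⟩)

theorem ensures_cut (h : IsWeightedRankOf M ω v) {C : Finset (Fin m)}
    (hC : M.Indep (C : Set (Fin m))) {N : ℝ≥0} (hN : v Finset.univ < N) (q : ℝ≥0) :
    Ensures v (cut C N q) 1 fun D =>
      D ⊆ C ∧ (∀ a ∈ D, q ≤ ω a) ∧ ∀ a ∈ C, a ∉ D → ω a ≤ q :=
  (ensures_demand _).weaken le_rfl fun _ hD => h.of_isDemanded_restrict hC hN hD

/-- An instance of `ensures_descent` with key `|ω - x|`. In a state, `s.1` holds items certified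
heavier than `x`, the complement of `s.2` in `C` those certified lighter, and `L s` the undecided
items of weight different from `x`. When `L s` is empty, all undecided items weigh exactly `x`. -/
theorem ensures_partition (h : IsWeightedRankOf M ω v) {C : Finset (Fin m)}
    (hC : M.Indep (C : Set (Fin m))) {N : ℝ≥0} (hN : v Finset.univ < N) {x : ℝ≥0} (hx : 0 < x) :
    Ensures v (partition C N x) (descentCost m) fun s =>
      s = (C.filter fun a => x < ω a, C.filter fun a => x ≤ ω a) := by
  set I : Finset (Fin m) × Finset (Fin m) → Prop := fun s =>
    s.1 ⊆ C ∧ s.2 ⊆ C ∧ (∀ a ∈ s.1, x < ω a) ∧ ∀ a ∈ C, a ∉ s.2 → ω a < x with hI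
  set L : Finset (Fin m) × Finset (Fin m) → Finset (Fin m) := fun s =>
    (s.2 \ s.1).filter fun a => ω a ≠ x with hL
  refine (ensures_cut h hC hN x).bind fun U hU => ?_
  refine (ensures_descent (I := I) (L := L) (fun i => |(ω i : ℝ) - x|) (a := 2) (c := 3) ?_ ?_ m
    (∅, C) ?_ ?_).weaken ?_ ?_
  · rintro s ⟨h1, h2, -, -⟩ S
    refine (Ensures.bind (c' := 1 + 0) (ensures_value _) ?_).weaken (by norm_num) fun _ h => h
    rintro _ rfl
    refine (ensures_value _).bind ?_
    rintro _ rfl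
    refine ensures_ret ?_
    set T := S ∩ (s.2 \ s.1) with hT
    have hTC : T ⊆ C := fun a ha =>
      h2 (Finset.mem_sdiff.1 (Finset.mem_inter.1 ha).2).1
    rw [h.eq_sum (hC.subset (Finset.coe_subset.2 (Finset.inter_subset_left.trans hTC))),
      h.eq_sum (hC.subset (Finset.coe_subset.2 (Finset.sdiff_subset.trans hTC)))]
    -- Since `U` is demanded at price `x`, it fixes the sign of `ω - x` on each item, so two values
    -- yield the total absolute deviation, which vanishes only if every deviation does.
    have key : ∑ a ∈ T ∩ U, (ω a : ℝ) - (T ∩ U).card * x +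
        ((T \ U).card * x - ∑ a ∈ T \ U, (ω a : ℝ)) = ∑ a ∈ T, |(ω a : ℝ) - x| := by
      rw [← Finset.sum_inter_add_sum_sdiff T U]
      congr 1
      · rw [← nsmul_eq_mul, ← Finset.sum_const, ← Finset.sum_sub_distrib]
        refine Finset.sum_congr rfl fun a ha => (abs_of_nonneg (sub_nonneg.2 ?_)).symm
        exact_mod_cast hU.2.1 a (Finset.mem_inter.1 ha).2
      · rw [← nsmul_eq_mul, ← Finset.sum_const, ← Finset.sum_sub_distrib]
        refine Finset.sum_congr rfl fun a ha => ?_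
        rw [abs_sub_comm, abs_of_nonneg (sub_nonneg.2 _)]
        exact_mod_cast hU.2.2 a (hTC (Finset.mem_sdiff.1 ha).1) (Finset.mem_sdiff.1 ha).2
    rw [key, decide_eq_true_iff, Ne, Finset.sum_eq_zero_iff_of_nonneg fun _ _ => abs_nonneg _]
    simp only [abs_eq_zero, sub_eq_zero, NNReal.coe_inj, not_forall, hT, hL, Finset.mem_inter,
      Finset.mem_filter, exists_prop, and_assoc, ne_eq]
  · rintro s ⟨h1, h2, h3, h4⟩ j hj
    simp only [hL, Finset.mem_filter, Finset.mem_sdiff] at hj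
    refine (Ensures.bind (c' := 1 + (1 + 0)) (ensures_value _) ?_).weaken (by norm_num)
      fun _ h => h
    rintro _ rfl
    have hjv : v {j} = ω j := by
      rw [h.eq_sum (hC.subset (by simpa using h2 hj.1.1)), Finset.sum_singleton]
    rw [hjv]
    set δ : ℝ := |(ω j : ℝ) - x| / 2 with hδ
    have hδ0 : 0 < δ := half_pos (abs_pos.2 (sub_ne_zero.2 fun he => hj.2 (NNReal.coe_inj.1 he)))
    have hxr : (0 : ℝ) < x := NNReal.coe_pos.2 hx
    refine (ensures_cut h hC hN _).bind fun P hP => (ensures_cut h hC hN _).bind fun Q hQ => ?_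
    have hP1 : ∀ a ∈ P, (x : ℝ) + δ ≤ ω a := fun a ha => Real.toNNReal_le_iff_le_coe.1 (hP.2.1 a ha)
    have hP2 : ∀ a ∈ C, a ∉ P → (ω a : ℝ) ≤ x + δ := fun a ha haP =>
      (Real.le_toNNReal_iff_coe_le (by positivity)).1 (hP.2.2 a ha haP)
    have hQ1 : ∀ a ∈ Q, (x : ℝ) - δ ≤ ω a := fun a ha => Real.toNNReal_le_iff_le_coe.1 (hQ.2.1 a ha)
    have hQ2 : ∀ a ∈ C, a ∉ Q → ω a < x := fun a ha haQ => by
      refine (hQ.2.2 a ha haQ).trans_lt ?_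
      -- The price `x - δ` may be negative and is then truncated to `0`; the strict bound by `x`
      -- survives because `x > 0`.
      rw [← NNReal.coe_lt_coe, Real.coe_toNNReal']
      exact max_lt (by linarith) hxr
    refine ensures_ret ⟨⟨Finset.union_subset h1 hP.1, Finset.inter_subset_left.trans h2, ?_, ?_⟩, ?_⟩
    · intro a ha
      rcases Finset.mem_union.1 ha with ha | ha
      · exact h3 a ha
      · exact NNReal.coe_lt_coe.1 (by linarith [hP1 a ha])
    · intro a ha haQ
      by_cases ha2 : a ∈ s.2
      · exact hQ2 a ha fun haQ' => haQ (Finset.mem_inter.2 ⟨ha2, haQ'⟩)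
      · exact h4 a ha ha2
    · intro a ha
      simp only [hL, Finset.mem_filter, Finset.mem_sdiff, Finset.mem_union, Finset.mem_inter,
        not_or] at ha ⊢
      obtain ⟨⟨⟨ha2, haQ⟩, ha1, haP⟩, hax⟩ := ha
      refine ⟨⟨⟨ha2, ha1⟩, hax⟩, ?_⟩
      have : |(ω a : ℝ) - x| ≤ δ :=
        abs_le.2 ⟨by linarith [hQ1 a haQ], by linarith [hP2 a (h2 ha2) haP]⟩
      linarith
  · exact ⟨by simp, subset_rfl, by simp, fun a ha ha' => absurd ha ha'⟩
  · exact (Finset.card_le_univ _).trans (by simp)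
  · gcongr
    exact harmonicENN_mono ((Finset.card_le_univ _).trans (by simp))
  · rintro ⟨P, Q⟩ ⟨⟨h1, h2, h3, h4⟩, hempty⟩
    simp only at h1 h2 h3 h4
    have heq : ∀ a ∈ Q, a ∉ P → ω a = x := fun a haQ haP => by
      by_contra hne
      exact Finset.notMem_empty a (hempty ▸ Finset.mem_filter.2 ⟨Finset.mem_sdiff.2 ⟨haQ, haP⟩, hne⟩)
    have hPeq : P = C.filter fun a => x < ω a := by
      ext a
      rw [Finset.mem_filter]
      refine ⟨fun ha => ⟨h1 ha, h3 a ha⟩, fun ⟨ha, hlt⟩ => ?_⟩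
      by_contra haP
      by_cases haQ : a ∈ Q
      · exact hlt.ne' (heq a haQ haP)
      · exact lt_asymm hlt (h4 a ha haQ)
    have hQeq : Q = C.filter fun a => x ≤ ω a := by
      ext a
      rw [Finset.mem_filter]
      refine ⟨fun ha => ⟨h2 ha, ?_⟩, fun ⟨ha, hle⟩ => ?_⟩
      · by_cases haP : a ∈ P
        · exact (h3 a haP).le
        · exact (heq a ha haP).ge
      · by_contra haQ
        exact absurd (h4 a ha haQ) (not_lt.2 hle)
    rw [hPeq, hQeq]

/-! ### Quickselect -/

/-- The `k`-th largest weight in `R`. -/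
theorem exists_threshold (ω : Fin m → ℝ≥0) (R : Finset (Fin m)) {k : ℕ} (hk : 0 < k)
    (hkR : k ≤ R.card) : ∃ t : ℝ≥0, (R.filter fun a => t < ω a).card < k ∧
      k ≤ (R.filter fun a => t ≤ ω a).card := by
  -- The threshold is the largest weight in `T`. If `k` items were strictly heavier, the lightest of
  -- them would belong to `T` as well.
  set T := R.filter fun b => k ≤ (R.filter fun a => ω b ≤ ω a).card with hT
  have hne : T.Nonempty := by
    obtain ⟨b, hb, hmin⟩ := R.exists_min_image ω (Finset.card_pos.1 (hk.trans_le hkR))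
    exact ⟨b, Finset.mem_filter.2 ⟨hb, by rwa [Finset.filter_true_of_mem hmin]⟩⟩
  obtain ⟨b, hb, hmax⟩ := T.exists_max_image ω hne
  refine ⟨ω b, ?_, (Finset.mem_filter.1 hb).2⟩
  by_contra hle
  rw [not_lt] at hle
  obtain ⟨c, hc, hmin⟩ := (R.filter fun a => ω b < ω a).exists_min_image ω
    (Finset.card_pos.1 (hk.trans_le hle))
  rw [Finset.mem_filter] at hc
  refine absurd (hmax c (Finset.mem_filter.2 ⟨hc.1, hle.trans (Finset.card_le_card ?_)⟩))
    (not_le.2 hc.2)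
  intro a ha
  exact Finset.mem_filter.2 ⟨(Finset.mem_filter.1 ha).1, hmin a ha⟩

/-- The expected decrease of the potential of quickselect. -/
theorem sum_select_le (ω : Fin m → ℝ≥0) (C : Finset (Fin m)) (t : ℝ≥0) :
    ∑ i ∈ C, (1 + if t < ω i then
        1 + harmonicENN (C.filter fun a => t < ω a ∧ ω a < ω i).card
          + harmonicENN (C.filter fun a => ω a < t).card
      else if ω i < t then
        1 + harmonicENN (C.filter fun a => t < ω a).card
          + harmonicENN (C.filter fun a => ω a < t ∧ ω i < ω a).card
      else 0) ≤
    C.card * (1 + harmonicENN (C.filter fun a => t < ω a).card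
      + harmonicENN (C.filter fun a => ω a < t).card) := by
  set U := C.filter fun a => t < ω a with hU
  set D := C.filter fun a => ω a < t with hD
  set E := C.filter fun a => ω a = t with hE
  -- A pivot above `t` shrinks only the upper harmonic term, one below `t` only the lower one, and
  -- one of weight `t` ends the search.
  have hsplit : ∀ F : Fin m → ℝ≥0∞, ∑ i ∈ C, F i = ∑ i ∈ U, F i + (∑ i ∈ D, F i + ∑ i ∈ E, F i) := by
    intro F
    rw [← Finset.sum_filter_add_sum_filter_not C (fun a => t < ω a)]
    congr 1
    rw [← Finset.sum_filter_add_sum_filter_not (C.filter fun a => ¬ t < ω a) (fun a => ω a < t)]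
    congr 1
    · refine Finset.sum_congr ?_ fun _ _ => rfl
      ext a
      simp only [hD, Finset.mem_filter, and_assoc, and_congr_right_iff]
      exact fun _ => ⟨fun h => h.2, fun h => ⟨h.asymm, h⟩⟩
    · refine Finset.sum_congr ?_ fun _ _ => rfl
      ext a
      simp only [hE, Finset.mem_filter, and_assoc, and_congr_right_iff, not_lt]
      exact fun _ => ⟨fun h => le_antisymm h.1 h.2, fun h => ⟨h.le, h.ge⟩⟩
  have hcard : (C.card : ℝ≥0∞) = U.card + (D.card + E.card) := by
    simpa using hsplit fun _ => 1
  have hUsum := sum_harmonicENN_card_lt (fun a => (ω a : ℝ)) U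
  have hDsum := sum_harmonicENN_card_lt (fun a => -(ω a : ℝ)) D
  rw [hsplit, hcard]
  have h1 : ∀ i ∈ U, (1 + if t < ω i then
        1 + harmonicENN (C.filter fun a => t < ω a ∧ ω a < ω i).card + harmonicENN D.card
      else if ω i < t then
        1 + harmonicENN U.card + harmonicENN (C.filter fun a => ω a < t ∧ ω i < ω a).card
      else 0) = harmonicENN (U.filter fun a => (ω a : ℝ) < ω i).card + (2 + harmonicENN D.card) := by
    intro i hi
    rw [if_pos (Finset.mem_filter.1 hi).2, hU, Finset.filter_filter]
    simp only [NNReal.coe_lt_coe]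
    ring
  have h2 : ∀ i ∈ D, (1 + if t < ω i then
        1 + harmonicENN (C.filter fun a => t < ω a ∧ ω a < ω i).card + harmonicENN D.card
      else if ω i < t then
        1 + harmonicENN U.card + harmonicENN (C.filter fun a => ω a < t ∧ ω i < ω a).card
      else 0) =
        harmonicENN (D.filter fun a => -(ω a : ℝ) < -ω i).card + (2 + harmonicENN U.card) := by
    intro i hi
    have hit := (Finset.mem_filter.1 hi).2
    rw [if_neg hit.asymm, if_pos hit, hD, Finset.filter_filter]
    simp only [neg_lt_neg_iff, NNReal.coe_lt_coe]
    ring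
  have h3 : ∀ i ∈ E, (1 + if t < ω i then
        1 + harmonicENN (C.filter fun a => t < ω a ∧ ω a < ω i).card + harmonicENN D.card
      else if ω i < t then
        1 + harmonicENN U.card + harmonicENN (C.filter fun a => ω a < t ∧ ω i < ω a).card
      else 0) = 1 := by
    intro i hi
    simp [(Finset.mem_filter.1 hi).2]
  rw [Finset.sum_congr rfl h1, Finset.sum_congr rfl h2, Finset.sum_congr rfl h3]
  simp only [Finset.sum_add_distrib, Finset.sum_const, nsmul_eq_mul, mul_one]
  set u := harmonicENN U.card
  set d := harmonicENN D.card
  calc _ = (∑ i ∈ U, harmonicENN (U.filter fun a => (ω a : ℝ) < ω i).card + U.card)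
        + (∑ i ∈ D, harmonicENN (D.filter fun a => -(ω a : ℝ) < -ω i).card + D.card)
        + (U.card * (1 + d) + D.card * (1 + u) + E.card) := by ring
    _ ≤ U.card * u + D.card * d
        + (U.card * (1 + d) + D.card * (1 + u) + E.card * (1 + u + d)) := by
      gcongr
      rw [add_assoc, mul_add, mul_one]
      exact le_self_add
    _ = _ := by ring

/-- The invariant is that `A` contains only items above the threshold `t` and that no item of weight
at least `t` is missing from `A ∪ C`. A round costs `1 + descentCost m`, and `sum_select_le` bounds
the expected number of rounds. -/
theorem ensures_select (h : IsWeightedRankOf M ω v) {R : Finset (Fin m)}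
    (hR : M.Indep (R : Set (Fin m))) (hpos : ∀ a ∈ R, 0 < ω a) {N : ℝ≥0}
    (hN : v Finset.univ < N) {k : ℕ} {t : ℝ≥0} (ht1 : (R.filter fun a => t < ω a).card < k)
    (ht2 : k ≤ (R.filter fun a => t ≤ ω a).card) (f : ℕ) (A C : Finset (Fin m))
    (hA : A ⊆ R.filter fun a => t < ω a) (hC : C ⊆ R)
    (hAC : (R.filter fun a => t ≤ ω a) ⊆ A ∪ C) (hf : C.card ≤ f) :
    Ensures v (select N k f A C) ((1 + descentCost m) *
      (1 + harmonicENN (C.filter fun a => t < ω a).card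
        + harmonicENN (C.filter fun a => ω a < t).card))
      fun S => S ⊆ R ∧ S.card = k ∧ (∀ a ∈ S, t ≤ ω a) ∧ ∀ a ∈ R \ S, ω a ≤ t := by
  induction f generalizing A C with
  | zero =>
    -- Without candidates, all items of weight at least `t` would lie above `t`, contradicting the
    -- choice of `t`; so the fuel never runs out.
    rw [Nat.le_zero, Finset.card_eq_zero] at hf
    rw [hf, Finset.union_empty] at hAC
    have := Finset.card_le_card (hAC.trans hA)
    omega
  | succ f ih =>
    have hCne : C.Nonempty := by
      rw [Finset.nonempty_iff_ne_empty]
      rintro rfl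
      rw [Finset.union_empty] at hAC
      have := Finset.card_le_card (hAC.trans hA)
      omega
    rw [select, dif_pos hCne]
    set K := 1 + descentCost m with hK
    intro g b hb
    rw [worstCost_bind, worstCost_pick]
    set G : Fin m → ℝ≥0∞ := fun i => (1 + if t < ω i then
        1 + harmonicENN (C.filter fun a => t < ω a ∧ ω a < ω i).card
          + harmonicENN (C.filter fun a => ω a < t).card
      else if ω i < t then
        1 + harmonicENN (C.filter fun a => t < ω a).card
          + harmonicENN (C.filter fun a => ω a < t ∧ ω i < ω a).card
      else 0) with hG
    have hround : ∀ i ∈ C, ((value {i} ret : QueryAlg m ℝ).bind fun x =>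
        (partition C N x.toNNReal).bind fun s =>
          if k ≤ (A ∪ s.1).card then select N k f A s.1
          else if k ≤ (A ∪ s.2).card then ret (between (A ∪ s.1) (A ∪ s.2) k)
          else select N k f (A ∪ s.2) (C \ s.2)).worstCost v g ≤ K * G i + b := by
      intro i hi
      have hiv : v {i} = ω i := by
        rw [h.eq_sum (hR.subset (by simpa using hC hi)), Finset.sum_singleton]
      have hAmem : ∀ a ∈ A, a ∈ R ∧ t < ω a := fun a ha => Finset.mem_filter.1 (hA ha)
      have hmem : ∀ a ∈ R, t ≤ ω a → a ∈ A ∨ a ∈ C := fun a ha hat =>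
        Finset.mem_union.1 (hAC (Finset.mem_filter.2 ⟨ha, hat⟩))
      have hG1 : K * G i = 1 + (descentCost m + K * if t < ω i then
        1 + harmonicENN (C.filter fun a => t < ω a ∧ ω a < ω i).card
          + harmonicENN (C.filter fun a => ω a < t).card
        else if ω i < t then
        1 + harmonicENN (C.filter fun a => t < ω a).card
          + harmonicENN (C.filter fun a => ω a < t ∧ ω i < ω a).card
        else 0) := by
        simp only [hG]
        rw [mul_add, mul_one]
        conv_lhs => rw [hK]
        rw [add_assoc]
      rw [hG1]
      refine Ensures.bind (Q := fun S => S ⊆ R ∧ S.card = k ∧ (∀ a ∈ S, t ≤ ω a) ∧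
        ∀ a ∈ R \ S, ω a ≤ t) (ensures_value _) ?_ g b hb
      rintro _ rfl
      rw [hiv, Real.toNNReal_coe]
      refine (ensures_partition h (hR.subset (Finset.coe_subset.2 hC)) hN (hpos i (hC hi))).bind ?_
      rintro _ rfl
      simp only
      -- The two cardinality tests reveal on which side of the unknown `t` the pivot lies: above,
      -- the items at least as heavy as it are accepted; below, only the heavier ones are kept; at
      -- `t`, ties are filled up arbitrarily.
      rcases lt_trichotomy t (ω i) with hlt | heq | hlt
      · have hsub : A ∪ C.filter (fun a => ω i ≤ ω a) ⊆ R.filter fun a => t < ω a := by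
          refine Finset.union_subset hA fun a ha => ?_
          rw [Finset.mem_filter] at ha ⊢
          exact ⟨hC ha.1, hlt.trans_le ha.2⟩
        have hc2 := (Finset.card_le_card hsub).trans_lt ht1
        have hc1 : (A ∪ C.filter fun a => ω i < ω a).card < k := by
          refine (Finset.card_le_card (Finset.union_subset_union_right ?_)).trans_lt hc2
          exact Finset.monotone_filter_right _ fun a _ h => h.le
        rw [if_neg (not_le.2 hc1), if_neg (not_le.2 hc2), if_pos hlt]
        have hdiff : C \ C.filter (fun a => ω i ≤ ω a) = C.filter fun a => ω a < ω i := by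
          ext a
          simp only [Finset.mem_sdiff, Finset.mem_filter, not_and, not_le]
          exact ⟨fun h => ⟨h.1, h.2 h.1⟩, fun h => ⟨h.1, fun _ => h.2⟩⟩
        rw [hdiff]
        refine (ih _ _ hsub ((Finset.filter_subset _ _).trans hC) ?_ ?_).weaken ?_ fun _ h => h
        · intro a ha
          rw [Finset.mem_filter] at ha
          simp only [Finset.mem_union, Finset.mem_filter]
          rcases hmem a ha.1 ha.2 with h1 | h1
          · exact Or.inl (Or.inl h1)
          · rcases le_or_gt (ω i) (ω a) with h2 | h2
            · exact Or.inl (Or.inr ⟨h1, h2⟩)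
            · exact Or.inr ⟨h1, h2⟩
        · have := Finset.card_lt_card (Finset.filter_ssubset.2
            ⟨i, hi, lt_irrefl (ω i)⟩ : C.filter (fun a => ω a < ω i) ⊂ C)
          omega
        · rw [Finset.filter_filter, Finset.filter_filter]
          gcongr
          · refine harmonicENN_mono (Finset.card_le_card ?_)
            exact Finset.monotone_filter_right _ fun a _ h => ⟨h.2, h.1⟩
          · refine harmonicENN_mono (Finset.card_le_card ?_)
            exact Finset.monotone_filter_right _ fun a _ h => h.2
      · rw [← heq]
        have hc1 : (A ∪ C.filter fun a => t < ω a).card < k := by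
          refine (Finset.card_le_card (Finset.union_subset hA fun a ha => ?_)).trans_lt ht1
          rw [Finset.mem_filter] at ha ⊢
          exact ⟨hC ha.1, ha.2⟩
        have hc2 : k ≤ (A ∪ C.filter fun a => t ≤ ω a).card := by
          refine ht2.trans (Finset.card_le_card fun a ha => ?_)
          rw [Finset.mem_filter] at ha
          rw [Finset.mem_union, Finset.mem_filter]
          exact (hmem a ha.1 ha.2).imp_right fun h1 => ⟨h1, ha.2⟩
        rw [if_neg (not_le.2 hc1), if_pos hc2]
        obtain ⟨h1, h2, h3⟩ := between_spec (Finset.union_subset_union_right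
          (Finset.monotone_filter_right C fun a _ (h : t < ω a) => h.le)) hc1.le hc2
        have h4 : ∀ a ∈ between (A ∪ C.filter fun a => t < ω a) (A ∪ C.filter fun a => t ≤ ω a) k,
            a ∈ R ∧ t ≤ ω a := by
          intro a ha
          rcases Finset.mem_union.1 (h2 ha) with h5 | h5
          · exact ⟨(hAmem a h5).1, (hAmem a h5).2.le⟩
          · rw [Finset.mem_filter] at h5
            exact ⟨hC h5.1, h5.2⟩
        refine (ensures_ret ⟨fun a ha => (h4 a ha).1, h3, fun a ha => (h4 a ha).2, fun a ha => ?_⟩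
          ).weaken zero_le fun _ h => h
        rw [Finset.mem_sdiff] at ha
        by_contra hat
        rw [not_le] at hat
        refine ha.2 (h1 (Finset.mem_union.2 ?_))
        exact (hmem a ha.1 hat.le).imp_right fun h5 => Finset.mem_filter.2 ⟨h5, hat⟩
      · have hsub : (R.filter fun a => t ≤ ω a) ⊆ A ∪ C.filter fun a => ω i < ω a := by
          intro a ha
          rw [Finset.mem_filter] at ha
          rw [Finset.mem_union, Finset.mem_filter]
          exact (hmem a ha.1 ha.2).imp_right fun h1 => ⟨h1, hlt.trans_le ha.2⟩
        rw [if_pos (ht2.trans (Finset.card_le_card hsub)), if_neg hlt.asymm, if_pos hlt]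
        refine (ih _ _ hA ((Finset.filter_subset _ _).trans hC) hsub ?_).weaken ?_ fun _ h => h
        · have := Finset.card_lt_card (Finset.filter_ssubset.2
            ⟨i, hi, lt_irrefl (ω i)⟩ : C.filter (fun a => ω i < ω a) ⊂ C)
          omega
        · rw [Finset.filter_filter, Finset.filter_filter]
          gcongr
          · refine harmonicENN_mono (Finset.card_le_card ?_)
            exact Finset.monotone_filter_right _ fun a _ h => h.2
          · refine harmonicENN_mono (Finset.card_le_card ?_)
            exact Finset.monotone_filter_right _ fun a _ h => ⟨h.2, h.1⟩
    calc _ ≤ (C.card : ℝ≥0∞)⁻¹ * ∑ i ∈ C, (K * G i + b) :=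
          mul_le_mul_right (Finset.sum_le_sum hround) _
      _ = (C.card : ℝ≥0∞)⁻¹ * (K * ∑ i ∈ C, G i + C.card * b) := by
          rw [Finset.sum_add_distrib, Finset.mul_sum, Finset.sum_const, nsmul_eq_mul]
      _ ≤ (C.card : ℝ≥0∞)⁻¹ * (K * (C.card * (1 + harmonicENN (C.filter fun a => t < ω a).card
      + harmonicENN (C.filter fun a => ω a < t).card)) + C.card * b) := by
          gcongr
          exact sum_select_le ω C t
      _ = (C.card : ℝ≥0∞)⁻¹ * (C.card * (K * (1 + harmonicENN (C.filter fun a => t < ω a).card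
      + harmonicENN (C.filter fun a => ω a < t).card) + b)) := by ring
      _ = _ := by
          rw [← mul_assoc, ENNReal.inv_mul_cancel (by simpa using hCne.ne_empty)
            (ENNReal.natCast_ne_top _), one_mul]

theorem ensures_findKOptimal (h : IsWeightedRankOf M ω v) {k : ℕ} (hk : k ≤ m) :
    Ensures v (findKOptimal m k) (descentCost m + (1 + (1 + descentCost m) *
      (1 + harmonicENN m + harmonicENN m))) (IsKOptimal v k) := by
  rw [findKOptimal]
  split_ifs with hk0
  · refine (ensures_ret ⟨by simp [hk0], fun T hT => ?_⟩).weaken zero_le fun _ h => h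
    rw [hk0, Finset.card_eq_zero] at hT
    rw [hT]
  refine (ensures_findBasis h).bind fun R hR => ?_
  split_ifs with hRk
  · obtain ⟨h1, -, h3⟩ := between_spec (Finset.subset_univ R) hRk (by simpa using hk)
    refine (ensures_ret ?_).weaken zero_le fun _ h => h
    have := h.isKOptimal_of_subset hR.1 h1
    rwa [h3] at this
  refine (ensures_value _).bind ?_
  rintro _ rfl
  -- The threshold enters only the analysis. It exists because `k` is positive, which is why `k = 0`
  -- is treated apart.
  obtain ⟨t, ht1, ht2⟩ := exists_threshold ω R (Nat.pos_of_ne_zero hk0) (not_le.1 hRk).le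
  have hcard : ∀ S : Finset (Fin m), harmonicENN S.card ≤ harmonicENN m := fun S =>
    harmonicENN_mono ((Finset.card_le_univ _).trans (by simp))
  refine (ensures_select h hR.1.1 hR.2 ?_ ht1 ht2 m ∅ R (by simp) subset_rfl
    (by simp) ((Finset.card_le_univ _).trans (by simp))).weaken ?_ ?_
  · exact (lt_add_one _).trans_le (Real.le_coe_toNNReal _)
  · gcongr
    · exact hcard _
    · exact hcard _
  · rintro S ⟨h1, h2, h3, h4⟩
    have := h.isKOptimal_of_threshold hR.1 t h1 h3 h4
    rwa [h2] at this

end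

end QueryAlg

/-! ### Logarithmic bounds on the costs -/

namespace QueryAlg

section Bounds

variable {m : ℕ}

theorem descentCost_ne_top (m : ℕ) : descentCost m ≠ ⊤ := by
  have h : (2 * (Nat.clog 2 m + 1) + 3 : ℝ≥0∞) = ((2 * (Nat.clog 2 m + 1) + 3 : ℕ) : ℝ≥0∞) := by
    push_cast
    rfl
  rw [descentCost, h]
  exact ENNReal.add_ne_top.2 ⟨ENNReal.one_ne_top, ENNReal.add_ne_top.2 ⟨ENNReal.ofNat_ne_top,
    ENNReal.mul_ne_top (ENNReal.natCast_ne_top _) (harmonicENN_ne_top m)⟩⟩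

theorem one_le_two_mul_log (hm : 2 ≤ m) : 1 ≤ 2 * Real.log m := by
  have h1 : Real.log 2 ≤ Real.log m := Real.log_le_log two_pos (by exact_mod_cast hm)
  linarith [Real.log_two_gt_d9]

theorem one_le_two_mul_ofReal_log (hm : 2 ≤ m) : 1 ≤ 2 * ENNReal.ofReal (Real.log m) := by
  have h := ENNReal.ofReal_le_ofReal (one_le_two_mul_log hm)
  rwa [ENNReal.ofReal_one, ENNReal.ofReal_mul two_pos.le, ENNReal.ofReal_ofNat] at h

theorem harmonicENN_le_log (hm : 2 ≤ m) : harmonicENN m ≤ 3 * ENNReal.ofReal (Real.log m) := by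
  rw [harmonicENN_eq_ofReal, ← ENNReal.ofReal_ofNat 3, ← ENNReal.ofReal_mul (by norm_num)]
  refine ENNReal.ofReal_le_ofReal ((harmonic_le_one_add_log m).trans ?_)
  linarith [one_le_two_mul_log hm]

theorem clog_le_log (hm : 2 ≤ m) : (Nat.clog 2 m : ℝ≥0∞) ≤ 4 * ENNReal.ofReal (Real.log m) := by
  have h0 := one_le_two_mul_log hm
  have h1 : ((Nat.clog 2 m - 1 : ℕ) : ℝ) * Real.log 2 ≤ Real.log m := by
    rw [← Real.log_pow]
    refine Real.log_le_log (by positivity) ?_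
    exact_mod_cast (Nat.pow_pred_clog_lt_self one_lt_two (by omega)).le
  have h2 : (Nat.clog 2 m : ℝ) ≤ ((Nat.clog 2 m - 1 : ℕ) : ℝ) + 1 := by
    exact_mod_cast (by omega : Nat.clog 2 m ≤ Nat.clog 2 m - 1 + 1)
  have h3 : (Nat.clog 2 m : ℝ) ≤ 4 * Real.log m := by
    have h4 : (0 : ℝ) ≤ ((Nat.clog 2 m - 1 : ℕ) : ℝ) := Nat.cast_nonneg _
    nlinarith [Real.log_two_gt_d9]
  rw [← ENNReal.ofReal_natCast, ← ENNReal.ofReal_ofNat 4, ← ENNReal.ofReal_mul (by norm_num)]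
  exact ENNReal.ofReal_le_ofReal h3

theorem descentCost_le (hm : 2 ≤ m) :
    descentCost m ≤ 66 * ENNReal.ofReal (Real.log m) ^ 2 := by
  have h1 := one_le_two_mul_ofReal_log hm
  have h2 := harmonicENN_le_log hm
  have h3 := clog_le_log hm
  set x := ENNReal.ofReal (Real.log m)
  -- Factors `1` are written out so that each can be replaced by its upper bound `2 * x`, which
  -- makes every term quadratic in the logarithm.
  calc descentCost m = 3 * (1 * 1) + (2 * Nat.clog 2 m + 5 * 1) * harmonicENN m := by
        rw [descentCost]
        ring
    _ ≤ 3 * ((2 * x) * (2 * x)) + (2 * (4 * x) + 5 * (2 * x)) * (3 * x) := by gcongr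
    _ = _ := by ring

theorem kOptimalCost_le (hm : 2 ≤ m) :
    descentCost m + (1 + (1 + descentCost m) * (1 + harmonicENN m + harmonicENN m)) ≤
      700 * ENNReal.ofReal (Real.log m) ^ 3 := by
  have h1 := one_le_two_mul_ofReal_log hm
  have h2 := harmonicENN_le_log hm
  have h3 := descentCost_le hm
  set x := ENNReal.ofReal (Real.log m)
  calc _ = descentCost m * 1 + (1 * (1 * 1) +
        (1 * 1 + descentCost m) * (1 + harmonicENN m + harmonicENN m)) := by ring
    _ ≤ 66 * x ^ 2 * (2 * x) + ((2 * x) * ((2 * x) * (2 * x)) +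
        ((2 * x) * (2 * x) + 66 * x ^ 2) * (2 * x + 3 * x + 3 * x)) := by gcongr
    _ = 700 * x ^ 3 := by ring

theorem ofReal_mul_log_pow (c : ℕ) (m n : ℕ) :
    ENNReal.ofReal (c * Real.log m ^ n) = c * ENNReal.ofReal (Real.log m) ^ n := by
  rw [ENNReal.ofReal_mul (Nat.cast_nonneg c), ENNReal.ofReal_natCast,
    ENNReal.ofReal_pow (Real.log_natCast_nonneg m)]

end Bounds

end QueryAlg

theorem mainTheorem2 :
    (∃ (C : ℝ) (alg : (m k : ℕ) → QueryAlg m (Finset (Fin m))),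
      ∀ (m k : ℕ), k ≤ m →
        ∀ v : Finset (Fin m) → ℝ, IsWeightedMatroidRank v →
          ∀ O : DemandOracle v,
            (∀ S : Finset (Fin m), (alg m k).IsOutput v O S → IsKOptimal v k S) ∧
            (2 ≤ m →
              (alg m k).expectedQueries v O ≤ ENNReal.ofReal (C * Real.log (m : ℝ) ^ 3))) ∧
    (∃ (C : ℝ) (find : (m : ℕ) → QueryAlg m (Finset (Fin m))),
      ∀ (m : ℕ) (M : Matroid (Fin m)) (ω : Fin m → ℝ≥0) (v : Finset (Fin m) → ℝ),
        IsWeightedRankOf M ω v →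
          ∀ O : DemandOracle v,
            (∀ R : Finset (Fin m), (find m).IsOutput v O R → IsMaxWeightIndep M ω R) ∧
            (2 ≤ m →
              (find m).expectedQueries v O ≤ ENNReal.ofReal (C * Real.log (m : ℝ) ^ 2))) := by
  refine ⟨⟨(700 : ℕ), QueryAlg.findKOptimal, ?_⟩, (66 : ℕ), QueryAlg.findBasis, ?_⟩
  · rintro m k hk v ⟨M, ω, h⟩ O
    have hE := QueryAlg.ensures_findKOptimal h hk
    have hh := harmonicENN_ne_top m
    have hd := QueryAlg.descentCost_ne_top m
    refine ⟨fun S hS => hE.of_isOutput ?_ O hS, fun hm => ?_⟩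
    · finiteness
    · rw [QueryAlg.ofReal_mul_log_pow]
      exact (hE.expectedQueries_le O).trans (by exact_mod_cast QueryAlg.kOptimalCost_le hm)
  · intro m M ω v h O
    have hE := QueryAlg.ensures_findBasis h
    refine ⟨fun R hR => (hE.of_isOutput (QueryAlg.descentCost_ne_top m) O hR).1, fun hm => ?_⟩
    rw [QueryAlg.ofReal_mul_log_pow]
    exact (hE.expectedQueries_le O).trans (by exact_mod_cast QueryAlg.descentCost_le hm)
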